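/- Let $G$ be a finite group. A subgroup $H$ of $G$ is called \emph{characteristic} if $\varphi(H)\le H$ for every automorphism $\varphi$ of $G$, and \emph{fully invariant} if $\varphi(H)\le H$ for every endomorphism $\varphi$ of $G$. A \emph{group word} is a formal expression in variables $x_0,x_1,x_2,\dots$ and the group operations (multiplication, inverses, identity). $H$ is called \emph{verbal} if there is a set $W$ of group words such that $H$ is the subgroup generated by all elements obtained by substituting elements of $G$ for the variables in the words of $W$. The group $G$ is called \emph{characteristically simple} (respectively \emph{invariantly simple}, \emph{verbally simple}) if its only characteristic (respectively fully invariant, verbal) subgroups are the trivial subgroup and $G$ itself. \textbf{Theorem.} For every finite group $G$ the following statements are equivalent: \begin{enumerate} \item[(1)] $G$ is characteristically simple; \item[(2)] $G$ is invariantly simple; \item[(3)] $G$ is verbally simple; \item[(4)] $G$ is isomorphic to a direct product $S_1\times\cdots\times S_n$ of finitely many pairwise isomorphic simple groups. \end{enumerate} Here simple groups are nontrivial by definition, and $n=0$ (the empty product, which is the trivial group) is allowed in (4). -/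

import Mathlib

universe u

/-- A subgroup `H` of `G` is fully invariant if every endomorphism of `G` maps `H` into `H`. -/
def Subgroup.IsFullyInvariant {G : Type u} [Group G] (H : Subgroup G) : Prop :=
  ∀ φ : G →* G, H.map φ ≤ H

/-- The verbal subgroup of `G` for a set `W` of group words in the variables `x₀, x₁, x₂, …`: the
subgroup generated by all values in `G` of the words in `W`. A word is an element of the free group
on the variables, and `FreeGroup.lift v w` is its value when `v i` is substituted for `xᵢ`. -/
def verbalSubgroup (W : Set (FreeGroup ℕ)) (G : Type u) [Group G] : Subgroup G :=
  Subgroup.closure {g : G | ∃ w ∈ W, ∃ v : ℕ → G, g = FreeGroup.lift v w}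

/-- A subgroup is verbal if it is the verbal subgroup for some set of group words. -/
def Subgroup.IsVerbal {G : Type u} [Group G] (H : Subgroup G) : Prop :=
  ∃ W : Set (FreeGroup ℕ), H = verbalSubgroup W G

/-- The only characteristic subgroups are the trivial subgroup and the whole group. -/
def IsCharacteristicallySimple (G : Type u) [Group G] : Prop :=
  ∀ H : Subgroup G, H.Characteristic → H = ⊥ ∨ H = ⊤

/-- The only fully invariant subgroups are the trivial subgroup and the whole group. -/
def IsInvariantlySimple (G : Type u) [Group G] : Prop :=
  ∀ H : Subgroup G, H.IsFullyInvariant → H = ⊥ ∨ H = ⊤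

/-- The only verbal subgroups are the trivial subgroup and the whole group. -/
def IsVerballySimple (G : Type u) [Group G] : Prop :=
  ∀ H : Subgroup G, H.IsVerbal → H = ⊥ ∨ H = ⊤

/-- `G` is (isomorphic to) the direct product `S₁ × ⋯ × Sₙ` of finitely many simple groups that are
pairwise isomorphic. The product with `n = 0` factors is the trivial group. -/
def IsProductOfIsomorphicSimpleGroups (G : Type u) [Group G] : Prop :=
  ∃ (n : ℕ) (S : Fin n → Type u) (_ : ∀ i, Group (S i)),
    (∀ i, IsSimpleGroup (S i)) ∧ (∀ i j, Nonempty (S i ≃* S j)) ∧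
      Nonempty (G ≃* ((i : Fin n) → S i))

/-! Verbal subgroups are fully invariant and fully invariant ones are characteristic, so the content
is (4) ⇒ (1) and (3) ⇒ (4).

For (4) ⇒ (1), a nontrivial characteristic subgroup of a power of a simple group contains a
nontrivial element supported in one coordinate, hence that whole factor, and coordinate swaps give
the others.

For (3) ⇒ (4), every word is a law of `G` or its values generate `G`. The commutator word makes `G`
abelian or perfect. If abelian, the word `x ^ p` makes it a vector space over `ZMod p`. If perfect
and nontrivial, take `N` proper normal of minimal index, so `G ⧸ N` is simple; every law of `G ⧸ N`
is a law of `G`. Let `F` be free on `G`, with its canonical map onto `G`. An element of `F` killed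
by all of the finitely many maps `F →* G ⧸ N` is then trivial in `G`. Kernels that map onto `G` can
be ignored, by perfectness; the others have proper images in `G`, which are normal with quotient `G
⧸ N`, pairwise comaximal and of trivial intersection. The Chinese remainder theorem finishes. -/

theorem Subgroup.IsFullyInvariant.characteristic {G : Type u} [Group G] {H : Subgroup G}
    (h : H.IsFullyInvariant) : H.Characteristic :=
  Subgroup.characteristic_iff_map_le.2 fun φ => h φ.toMonoidHom

theorem Subgroup.IsVerbal.isFullyInvariant {G : Type u} [Group G] {H : Subgroup G}
    (h : H.IsVerbal) : H.IsFullyInvariant := by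
  obtain ⟨W, rfl⟩ := h
  intro φ
  rw [Subgroup.map_le_iff_le_comap, verbalSubgroup, Subgroup.closure_le]
  rintro _ ⟨w, hw, v, rfl⟩
  refine Subgroup.subset_closure ⟨w, hw, φ ∘ v, ?_⟩
  have : φ.comp (FreeGroup.lift v) = FreeGroup.lift (φ ∘ v) := by ext; simp
  exact DFunLike.congr_fun this w

/-! ### Powers of a simple group are characteristically simple -/

theorem IsCharacteristicallySimple.of_mulEquiv {G H : Type u} [Group G] [Group H] (e : G ≃* H)
    (h : IsCharacteristicallySimple H) : IsCharacteristicallySimple G := by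
  intro K hK
  have hc : (K.map e.toMonoidHom).Characteristic := by
    refine Subgroup.characteristic_iff_map_le.2 fun φ => ?_
    rintro _ ⟨_, ⟨x, hx, rfl⟩, rfl⟩
    refine ⟨(e.trans (φ.trans e.symm)) x, ?_, by simp⟩
    exact Subgroup.characteristic_iff_map_le.1 hK _ (Subgroup.mem_map_of_mem _ hx)
  rcases h _ hc with h | h
  · exact Or.inl ((Subgroup.map_eq_bot_iff_of_injective _ e.injective).1 h)
  · right
    have := congrArg (Subgroup.comap e.toMonoidHom) h
    rwa [Subgroup.comap_map_eq_self_of_injective e.injective, Subgroup.comap_top] at this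

/-- The automorphism of a power of a commutative group multiplying the `j`-th coordinate by the
`i`-th one. -/
def piTransvection {ι S : Type*} [DecidableEq ι] [Group S] (hS : ∀ a b : S, a * b = b * a)
    {i j : ι} (hij : j ≠ i) : (ι → S) ≃* (ι → S) where
  toFun x := x * Pi.mulSingle j (x i)
  invFun x := x * Pi.mulSingle j (x i)⁻¹
  left_inv x := by simp [mul_assoc, ← Pi.mulSingle_mul, Pi.mulSingle_eq_of_ne hij.symm]
  right_inv x := by simp [mul_assoc, ← Pi.mulSingle_mul, Pi.mulSingle_eq_of_ne hij.symm]
  map_mul' x y := by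
    ext k
    simp only [Pi.mul_apply, Pi.mulSingle_mul]
    rw [mul_assoc, mul_assoc, ← mul_assoc (y k), hS (y k), mul_assoc]

theorem exists_mulSingle_mem_of_characteristic {ι S : Type*} [DecidableEq ι] [Group S]
    [IsSimpleGroup S] {H : Subgroup (ι → S)} (hH : H.Characteristic) {x : ι → S} (hx : x ∈ H)
    {i : ι} (hi : x i ≠ 1) : ∃ j, ∃ s : S, s ≠ 1 ∧ Pi.mulSingle j s ∈ H := by
  have hn : H.Normal := inferInstance
  by_cases hS : ∀ a b : S, a * b = b * a
  · by_cases hj : ∃ j, j ≠ i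
    · obtain ⟨j, hj⟩ := hj
      refine ⟨j, x i, hi, ?_⟩
      -- The transvection changes `x` exactly by the factor `Pi.mulSingle j (x i)`.
      have := Subgroup.characteristic_iff_map_le.1 hH (piTransvection hS hj)
        (Subgroup.mem_map_of_mem _ hx)
      exact (Subgroup.mul_mem_cancel_left _ hx).1 this
    · refine ⟨i, x i, hi, ?_⟩
      convert hx using 1
      ext k
      obtain rfl : k = i := by by_contra hk; exact hj ⟨k, hk⟩
      simp
  · by_cases hc : ∀ s, s * x i = x i * s
    · have hz : Subgroup.center S ≠ ⊥ := fun h =>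
        hi (by simpa [h] using Subgroup.mem_center_iff.2 hc)
      have ht := ((inferInstance : (Subgroup.center S).Normal).eq_bot_or_eq_top).resolve_left hz
      exact absurd (fun a b => Subgroup.mem_center_iff.1 (ht ▸ Subgroup.mem_top b) a) hS
    · push Not at hc
      obtain ⟨s, hs⟩ := hc
      -- The commutator of `x` with an element of the `i`-th factor is supported at `i`.
      refine ⟨i, s * x i * s⁻¹ * (x i)⁻¹, ?_, ?_⟩
      · intro h
        apply hs
        rw [mul_inv_eq_one, mul_inv_eq_iff_eq_mul] at h
        exact h
      · have := H.mul_mem (hn.conj_mem x hx (Pi.mulSingle i s)) (H.inv_mem hx)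
        convert this using 1
        ext k
        by_cases hk : k = i
        · subst hk; simp
        · simp [Pi.mulSingle_eq_of_ne hk]

theorem isCharacteristicallySimple_pi {ι S : Type u} [Finite ι] [Group S]
    [IsSimpleGroup S] : IsCharacteristicallySimple (ι → S) := by
  classical
  intro H hH
  have hn : H.Normal := inferInstance
  refine or_iff_not_imp_left.2 fun hne => ?_
  obtain ⟨x, hx, hx1⟩ := H.bot_or_exists_ne_one.resolve_left hne
  obtain ⟨i, hi⟩ := Function.ne_iff.1 hx1
  obtain ⟨j, s, hs, hsH⟩ := exists_mulSingle_mem_of_characteristic hH hx hi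
  have hj : H.comap (MonoidHom.mulSingle (fun _ => S) j) = ⊤ := by
    refine ((hn.comap _).eq_bot_or_eq_top).resolve_left fun h => hs ?_
    exact (Subgroup.mem_bot (G := S)).1 (h ▸ Subgroup.mem_comap.2 hsH)
  rw [← top_le_iff, ← Subgroup.pi_top Set.univ, Subgroup.pi_le_iff]
  rintro k _ ⟨t, -, rfl⟩
  have ht : Pi.mulSingle j t ∈ H := Subgroup.mem_comap.1 (hj ▸ Subgroup.mem_top t)
  have := Subgroup.characteristic_iff_map_le.1 hH
    (MulEquiv.arrowCongr (Equiv.swap j k) (MulEquiv.refl S)) (Subgroup.mem_map_of_mem _ ht)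
  convert this using 1
  ext l
  simp [Pi.mulSingle_apply, Equiv.swap_apply_eq_iff]

theorem IsProductOfIsomorphicSimpleGroups.isCharacteristicallySimple {G : Type u} [Group G]
    (h : IsProductOfIsomorphicSimpleGroups G) : IsCharacteristicallySimple G := by
  obtain ⟨n, S, _, hS, hiso, ⟨e⟩⟩ := h
  rcases n with _ | n
  · have : Subsingleton G := e.toEquiv.subsingleton
    exact fun H _ => Or.inl (Subsingleton.elim _ _)
  · have := hS 0
    let e₁ : ((i : Fin (n + 1)) → S i) ≃* (Fin (n + 1) → S 0) :=
      MulEquiv.piCongrRight fun i => (hiso i 0).some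
    -- The index type is lifted to the universe of `S 0`.
    let e₂ : (Fin (n + 1) → S 0) ≃* (ULift.{u} (Fin (n + 1)) → S 0) :=
      MulEquiv.arrowCongr Equiv.ulift.symm (MulEquiv.refl _)
    exact .of_mulEquiv (e.trans (e₁.trans e₂)) isCharacteristicallySimple_pi

/-! ### Commutative verbally simple groups -/

theorem IsVerballySimple.lift_eq_one_or {G : Type u} [Group G] (h : IsVerballySimple G)
    (w : FreeGroup ℕ) : (∀ v : ℕ → G, FreeGroup.lift v w = 1) ∨ verbalSubgroup {w} G = ⊤ := by
  refine (h _ ⟨{w}, rfl⟩).imp_left fun hb v => ?_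
  exact (Subgroup.mem_bot).1 (hb ▸ Subgroup.subset_closure ⟨w, rfl, v, rfl⟩)

theorem exists_addEquiv_fin_zmod {V : Type*} [AddCommGroup V] [Finite V] {p : ℕ}
    [Fact p.Prime] [Module (ZMod p) V] : ∃ n : ℕ, Nonempty (V ≃+ (Fin n → ZMod p)) :=
  ⟨_, ⟨(Module.finBasis (ZMod p) V).equivFun.toAddEquiv⟩⟩

theorem isProduct_of_exponent_prime {G : Type u} [CommGroup G] [Finite G] {p : ℕ}
    [Fact p.Prime] (h : ∀ x : G, x ^ p = 1) : IsProductOfIsomorphicSimpleGroups G := by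
  let _ : Module (ZMod p) (Additive G) := AddCommGroup.zmodModule fun x => h x.toMul
  obtain ⟨n, ⟨e⟩⟩ := exists_addEquiv_fin_zmod (V := Additive G) (p := p)
  refine ⟨n, fun _ => ULift (Multiplicative (ZMod p)),
    fun _ => inferInstance, fun _ => isSimpleGroup_of_prime_card (p := p) (by simp),
    fun _ _ => ⟨MulEquiv.refl _⟩, ⟨?_⟩⟩
  exact
    { toFun := fun g i => ⟨.ofAdd (e (.ofMul g) i)⟩
      invFun := fun f => (e.symm fun i => (f i).down.toAdd).toMul
      left_inv := fun g => by simp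
      right_inv := fun f => by
        funext i
        apply ULift.ext
        simp
      map_mul' := fun x y => by
        funext i
        apply ULift.ext
        simp }

theorem IsVerballySimple.isProduct_of_commGroup {G : Type u} [CommGroup G] [Finite G]
    (h : IsVerballySimple G) : IsProductOfIsomorphicSimpleGroups G := by
  rcases subsingleton_or_nontrivial G with hs | hn
  · have : Unique G := ⟨⟨1⟩, fun _ => Subsingleton.elim _ _⟩
    exact ⟨0, fun _ => PUnit, fun _ => inferInstance, fun i => i.elim0, fun i => i.elim0,
      ⟨MulEquiv.ofUnique⟩⟩
  obtain ⟨p, hp, hdvd⟩ := Nat.exists_prime_and_dvd (n := Nat.card G) Finite.one_lt_card.ne'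
  have := Fact.mk hp
  refine isProduct_of_exponent_prime (p := p) ?_
  rcases h.lift_eq_one_or (FreeGroup.of 0 ^ p) with h | h
  · exact fun x => by simpa using h fun _ => x
  -- Otherwise the `p`-th power map is onto, hence injective, against Cauchy's theorem.
  · have hle : verbalSubgroup {FreeGroup.of 0 ^ p} G ≤ (powMonoidHom p : G →* G).range := by
      rw [verbalSubgroup, Subgroup.closure_le]
      rintro _ ⟨_, rfl, v, rfl⟩
      exact ⟨v 0, by simp⟩
    rw [h, top_le_iff, MonoidHom.range_eq_top] at hle
    have hinj := Finite.injective_iff_surjective.2 hle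
    obtain ⟨x, hx⟩ := exists_prime_orderOf_dvd_card' p hdvd
    have : x = 1 := hinj (by simp [← hx, pow_orderOf_eq_one])
    rw [this, orderOf_one] at hx
    exact absurd hx.symm hp.one_lt.ne'

/-! ### Normal subgroups of perfect groups -/

/-- The commutator of `A` and `B` lies in both and maps onto the commutator subgroup of `G`. -/
theorem Subgroup.map_inf_eq_top_of_perfect {F G : Type*} [Group F] [Group G] (f : F →* G)
    (hG : _root_.commutator G = ⊤) {A B : Subgroup F} [A.Normal] [B.Normal] (hA : A.map f = ⊤)
    (hB : B.map f = ⊤) : (A ⊓ B).map f = ⊤ := by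
  have h : (⁅A, B⁆).map f = ⊤ := by rw [Subgroup.map_commutator, hA, hB, ← _root_.commutator_def, hG]
  exact top_le_iff.1 (h ▸ Subgroup.map_mono (Subgroup.commutator_le_inf A B))

theorem Subgroup.map_iInf_eq_top_of_perfect {F G ι : Type*} [Group F] [Group G] (f : F →* G)
    (hf : Function.Surjective f) (hG : _root_.commutator G = ⊤) (t : Finset ι) (A : ι → Subgroup F)
    (hn : ∀ i, (A i).Normal) (hA : ∀ i ∈ t, (A i).map f = ⊤) :
    (⨅ i ∈ t, A i).map f = ⊤ := by
  classical
  induction t using Finset.induction_on with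
  | empty => simpa using Subgroup.map_top_of_surjective f hf
  | insert a t _ ih =>
    rw [Finset.iInf_insert]
    have : (⨅ i ∈ t, A i).Normal := Subgroup.normal_iInf_normal fun i =>
      Subgroup.normal_iInf_normal fun _ => hn i
    have := hn a
    exact map_inf_eq_top_of_perfect f hG (hA a (by simp)) (ih fun i hi => hA i (by simp [hi]))

/-- The Chinese remainder theorem for pairwise comaximal normal subgroups of a perfect group. -/
theorem Subgroup.exists_forall_inv_mul_mem_of_perfect {G : Type*} [Group G]
    (hG : _root_.commutator G = ⊤) (t : Finset (Subgroup G)) (hn : ∀ N ∈ t, N.Normal)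
    (ht : ∀ M ∈ t, ∀ N ∈ t, M ≠ N → M ⊔ N = ⊤) (c : Subgroup G → G) :
    ∃ q : G, ∀ N ∈ t, (c N)⁻¹ * q ∈ N := by
  classical
  induction t using Finset.induction_on with
  | empty => exact ⟨1, by simp⟩
  | insert M t hM ih =>
    obtain ⟨q, hq⟩ := ih (fun N hN => hn N (by simp [hN]))
      fun A hA B hB => ht A (by simp [hA]) B (by simp [hB])
    have hMn := hn M (by simp)
    have htop : (⨅ i : {N // N ∈ t}, (i : Subgroup G)).map (QuotientGroup.mk' M) = ⊤ := by
      have hperf : _root_.commutator (G ⧸ M) = ⊤ := by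
        have := Subgroup.map_commutator ⊤ ⊤ (QuotientGroup.mk' M)
        rw [Subgroup.map_top_of_surjective _ (QuotientGroup.mk'_surjective M),
          ← _root_.commutator_def, ← _root_.commutator_def, hG,
          Subgroup.map_top_of_surjective _ (QuotientGroup.mk'_surjective M)] at this
        exact this.symm
      have := map_iInf_eq_top_of_perfect (QuotientGroup.mk' M) (QuotientGroup.mk'_surjective M)
        hperf (Finset.univ : Finset {N // N ∈ t}) (fun N => N)
        (fun N => hn N (by simp)) fun N _ => by
          have h := ht N (by simp) M (by simp) (by rintro rfl; exact hM N.2)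
          have h' := Subgroup.comap_map_eq (QuotientGroup.mk' M) (N : Subgroup G)
          rw [QuotientGroup.ker_mk', h] at h'
          rw [← Subgroup.map_comap_eq_self_of_surjective (QuotientGroup.mk'_surjective M)
            ((N : Subgroup G).map _), h',
            Subgroup.map_top_of_surjective _ (QuotientGroup.mk'_surjective M)]
      simpa using this
    -- Multiplying by `b` corrects `q` modulo `M` without disturbing the congruences in `t`.
    obtain ⟨b, hb, hbq⟩ : ((q⁻¹ * c M : G) : G ⧸ M) ∈
        (⨅ i : {N // N ∈ t}, (i : Subgroup G)).map (QuotientGroup.mk' M) := htop ▸ mem_top _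
    refine ⟨q * b, fun N hN => ?_⟩
    rcases Finset.mem_insert.1 hN with rfl | hN
    · have h := QuotientGroup.eq.1 hbq.symm
      simpa [mul_assoc] using h
    · rw [← mul_assoc]
      exact N.mul_mem (hq N hN) (Subgroup.mem_iInf.1 hb ⟨N, hN⟩)

theorem isProduct_of_finset_normal {G : Type u} [Group G] (hG : commutator G = ⊤) {S : Type u}
    [Group S] [IsSimpleGroup S] (t : Finset (Subgroup G)) (hn : ∀ N ∈ t, N.Normal)
    (hS : ∀ N (hN : N ∈ t), haveI := hn N hN; Nonempty (G ⧸ N ≃* S))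
    (ht : ∀ M ∈ t, ∀ N ∈ t, M ≠ N → M ⊔ N = ⊤) (hbot : ∀ x, (∀ N ∈ t, x ∈ N) → x = 1) :
    IsProductOfIsomorphicSimpleGroups G := by
  classical
  let e := t.equivFin.symm
  have (i : Fin t.card) : (e i : Subgroup G).Normal := hn _ (e i).2
  have hi (i : Fin t.card) : Nonempty (G ⧸ (e i : Subgroup G) ≃* S) := hS _ (e i).2
  refine ⟨t.card, fun i => G ⧸ (e i : Subgroup G), fun i => inferInstance,
    fun i => (hi i).some.isSimpleGroup, fun i j => ⟨(hi i).some.trans (hi j).some.symm⟩,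
    ⟨MulEquiv.ofBijective (MonoidHom.pi fun i => QuotientGroup.mk' (e i : Subgroup G)) ⟨?_, ?_⟩⟩⟩
  · rw [injective_iff_map_eq_one]
    intro x hx
    refine hbot x fun N hN => ?_
    have := congrFun hx (e.symm ⟨N, hN⟩)
    have h := (QuotientGroup.eq_one_iff x).1 this
    simpa using h
  · intro f
    choose g hg using fun i => QuotientGroup.mk'_surjective (e i : Subgroup G) (f i)
    obtain ⟨q, hq⟩ := Subgroup.exists_forall_inv_mul_mem_of_perfect hG t hn ht
      fun N => if hN : N ∈ t then g (e.symm ⟨N, hN⟩) else 1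
    refine ⟨q, funext fun i => ?_⟩
    have h := hq _ (e i).2
    simp only [Subtype.coe_eta, Equiv.symm_apply_apply, Finset.coe_mem, dite_true] at h
    rw [← hg i]
    exact (QuotientGroup.eq.2 h).symm

/-! ### Proper normal subgroups of minimal index -/

/-- A proper normal subgroup whose index is minimal among proper normal subgroups. -/
structure Subgroup.IsMinIndexNormal {G : Type u} [Group G] (N : Subgroup G) : Prop where
  normal : N.Normal
  ne_top : N ≠ ⊤
  index_le : ∀ M : Subgroup G, M.Normal → M ≠ ⊤ → N.index ≤ M.index

theorem Subgroup.exists_isMinIndexNormal (G : Type u) [Group G] [Nontrivial G] :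
    ∃ N : Subgroup G, N.IsMinIndexNormal := by
  obtain ⟨N, ⟨hN, hN'⟩, hmin⟩ := (InvImage.wf (fun N : Subgroup G => N.index)
    Nat.lt_wfRel.wf).has_min {N : Subgroup G | N.Normal ∧ N ≠ ⊤} ⟨⊥, inferInstance, bot_ne_top⟩
  exact ⟨N, hN, hN', fun M hM hM' => not_lt.1 (hmin M ⟨hM, hM'⟩)⟩

theorem Subgroup.eq_of_le_of_index_le {G : Type*} [Group G] {H K : Subgroup G} (h : H ≤ K)
    (hH : H.index ≠ 0) (hi : H.index ≤ K.index) : H = K := by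
  have hm := Subgroup.relIndex_mul_index h
  refine le_antisymm h (Subgroup.relIndex_eq_one.1 ?_)
  have hle := Nat.le_of_dvd (Nat.pos_of_ne_zero hH) (Subgroup.index_dvd_of_le h)
  have heq : H.index = K.index := le_antisymm hi hle
  rw [heq] at hm
  exact Nat.eq_of_mul_eq_mul_right (Nat.pos_of_ne_zero (heq ▸ hH)) (by rw [hm, one_mul])

theorem Subgroup.IsMinIndexNormal.eq_of_le {G : Type u} [Group G] [Finite G] {N M : Subgroup G}
    (hN : N.IsMinIndexNormal) (hM : M.Normal) (hle : N ≤ M) (hM' : M ≠ ⊤) : N = M :=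
  eq_of_le_of_index_le hle Subgroup.index_ne_zero_of_finite (hN.index_le M hM hM')

theorem Subgroup.IsMinIndexNormal.isSimpleGroup {G : Type u} [Group G] [Finite G]
    {N : Subgroup G} [N.Normal] (hN : N.IsMinIndexNormal) : IsSimpleGroup (G ⧸ N) := by
  have : Nontrivial (G ⧸ N) := QuotientGroup.nontrivial_iff.2 hN.ne_top
  refine ⟨fun H hH => or_iff_not_imp_right.2 fun hne => ?_⟩
  have hs := QuotientGroup.mk'_surjective N
  have h := hN.eq_of_le (hH.comap (QuotientGroup.mk' N)) (QuotientGroup.le_comap_mk' N H)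
    fun h => hne (by
      rw [← map_comap_eq_self_of_surjective hs H, h, map_top_of_surjective _ hs])
  rw [← map_comap_eq_self_of_surjective hs H, ← h]
  exact QuotientGroup.map_mk'_self N

theorem Subgroup.IsMinIndexNormal.sup_eq_top {G : Type u} [Group G] [Finite G] {N M : Subgroup G}
    (hN : N.IsMinIndexNormal) (hM : M.IsMinIndexNormal) (hne : M ≠ N) : M ⊔ N = ⊤ := by
  by_contra h
  have := hN.normal
  have := hM.normal
  exact hne ((hM.eq_of_le inferInstance le_sup_left h).trans
    (hN.eq_of_le inferInstance le_sup_right h).symm)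

/-! ### Perfect verbally simple groups -/

/-- The image of the kernel of a homomorphism to `G ⧸ N`, for `N` of minimal index, is everything
or is again of minimal index, with the same quotient. -/
theorem Subgroup.IsMinIndexNormal.comap_map_ker_eq {F G : Type u} [Group F] [Group G] [Finite G]
    {N : Subgroup G} [N.Normal] (hN : N.IsMinIndexNormal) (f : F →* G)
    (hf : Function.Surjective f) (p : F →* G ⧸ N) (hp : p.ker.map f ≠ ⊤) :
    p.ker = (p.ker.map f).comap f ∧ Function.Surjective p ∧ (p.ker.map f).index = N.index := by
  have hM : (p.ker.map f).Normal := p.normal_ker.map f hf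
  have h1 := hN.index_le _ hM hp
  have h2 : p.ker.index ≤ N.index := by
    rw [Subgroup.index_ker, Subgroup.index]
    exact Subgroup.card_le_card_group p.range
  have h3 : p.ker.index ≠ 0 := by rw [Subgroup.index_ker]; exact Nat.card_pos.ne'
  have h4 : ((p.ker.map f).comap f).index = (p.ker.map f).index :=
    Subgroup.index_comap_of_surjective _ hf
  -- The index of `p.ker` is at most `N.index`, by the size of the range, and `N.index` is at most
  -- that of the larger subgroup, by minimality.
  have h5 := eq_of_le_of_index_le (Subgroup.le_comap_map f p.ker) h3 (h4 ▸ h2.trans h1)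
  have h6 : p.ker.index = (p.ker.map f).index := (congrArg Subgroup.index h5).trans h4
  refine ⟨h5, ?_, le_antisymm (h6 ▸ h2) h1⟩
  rw [← MonoidHom.range_eq_top]
  apply Subgroup.eq_top_of_le_card
  rw [← Subgroup.index_ker, h6]
  exact h1

/-- A law of `G ⧸ N` takes values in `N` on `G`, so its verbal subgroup is proper, hence trivial.
The variables are renamed injectively into `ℕ`. -/
theorem IsVerballySimple.lift_eq_one_of_forall {G : Type u} [Group G] [Finite G]
    (h : IsVerballySimple G) {N : Subgroup G} [N.Normal] (hN : N ≠ ⊤) {w : FreeGroup G}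
    (hw : ∀ v : G → G ⧸ N, FreeGroup.lift v w = 1) : FreeGroup.lift id w = 1 := by
  obtain ⟨e, he⟩ : ∃ e : G → ℕ, Function.Injective e := Countable.exists_injective_nat G
  have hlift {H : Type u} [Group H] (v : ℕ → H) :
      FreeGroup.lift v (FreeGroup.map e w) = FreeGroup.lift (v ∘ e) w := by
    have : (FreeGroup.lift v).comp (FreeGroup.map e) = FreeGroup.lift (v ∘ e) := by ext; simp
    exact DFunLike.congr_fun this w
  rcases h.lift_eq_one_or (FreeGroup.map e w) with h | h
  · have := h (Function.invFun e)
    rwa [hlift, Function.invFun_comp he] at this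
  · refine absurd (top_le_iff.1 (h ▸ ?_)) hN
    rw [verbalSubgroup, Subgroup.closure_le]
    rintro _ ⟨_, rfl, v, rfl⟩
    rw [SetLike.mem_coe, ← QuotientGroup.eq_one_iff, ← hw ((QuotientGroup.mk' N ∘ v) ∘ e), ← hlift]
    have : (QuotientGroup.mk' N).comp (FreeGroup.lift v) =
      FreeGroup.lift (QuotientGroup.mk' N ∘ v) := by ext; simp
    exact DFunLike.congr_fun this _

theorem IsVerballySimple.isProduct_of_perfect {G : Type u} [Group G] [Finite G] [Nontrivial G]
    (h : IsVerballySimple G) (hG : commutator G = ⊤) : IsProductOfIsomorphicSimpleGroups G := by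
  classical
  obtain ⟨N, hN⟩ := Subgroup.exists_isMinIndexNormal G
  have := hN.normal
  have := hN.isSimpleGroup
  let f : FreeGroup G →* G := FreeGroup.lift id
  have hf : Function.Surjective f := fun g => ⟨FreeGroup.of g, by simp [f]⟩
  let p (v : G → G ⧸ N) : FreeGroup G →* G ⧸ N := FreeGroup.lift v
  have := Fintype.ofFinite (G → G ⧸ N)
  let A : Finset (G → G ⧸ N) := {v | (p v).ker.map f ≠ ⊤}
  let B : Finset (G → G ⧸ N) := {v | (p v).ker.map f = ⊤}
  have hA {v} (hv : v ∈ A) := hN.comap_map_ker_eq f hf (p v) (by simpa [A] using hv)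
  have hmin {v} (hv : v ∈ A) : ((p v).ker.map f).IsMinIndexNormal :=
    ⟨(p v).normal_ker.map f hf, by simpa [A] using hv, (hA hv).2.2 ▸ hN.index_le⟩
  refine isProduct_of_finset_normal hG (S := G ⧸ N) (A.image fun v => (p v).ker.map f) ?_ ?_ ?_ ?_
  · intro M hM
    obtain ⟨v, -, rfl⟩ := Finset.mem_image.1 hM
    exact (p v).normal_ker.map f hf
  · intro M hM
    obtain ⟨v, hv, rfl⟩ := Finset.mem_image.1 hM
    have := (p v).normal_ker.map f hf
    let q := (QuotientGroup.mk' ((p v).ker.map f)).comp f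
    have hq : Function.Surjective q := (QuotientGroup.mk'_surjective _).comp hf
    have hk : q.ker = (p v).ker := by
      rw [← MonoidHom.comap_ker, QuotientGroup.ker_mk', ← (hA hv).1]
    exact ⟨(QuotientGroup.quotientKerEquivOfSurjective q hq).symm.trans
      ((QuotientGroup.quotientMulEquivOfEq hk).trans
        (QuotientGroup.quotientKerEquivOfSurjective (p v) (hA hv).2.1))⟩
  · intro M hM K hK hne
    obtain ⟨v, hv, rfl⟩ := Finset.mem_image.1 hM
    obtain ⟨v', hv', rfl⟩ := Finset.mem_image.1 hK
    exact (hmin hv').sup_eq_top (hmin hv) hne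
  · intro x hx
    have hB := Subgroup.map_iInf_eq_top_of_perfect f hf hG B (fun v => (p v).ker)
      (fun v => (p v).normal_ker) fun v hv => by simpa [B] using hv
    -- The lift `b` lies in every kernel indexed by `B`; for `v ∈ A` the kernel is the full preimage
    -- of its image, so it contains `b` too. Hence `b` is a law of `G ⧸ N`.
    obtain ⟨b, hb, rfl⟩ := hB ▸ Subgroup.mem_top x
    refine h.lift_eq_one_of_forall hN.ne_top fun v => ?_
    by_cases hv : v ∈ A
    · have hb' : b ∈ ((p v).ker.map f).comap f := hx _ (Finset.mem_image_of_mem _ hv)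
      rwa [← (hA hv).1] at hb'
    · have hb' := Subgroup.mem_iInf.1 (Subgroup.mem_iInf.1 hb v) (by simpa [A, B] using hv)
      exact hb'

theorem IsVerballySimple.isProductOfIsomorphicSimpleGroups {G : Type u} [Group G] [Finite G]
    (h : IsVerballySimple G) : IsProductOfIsomorphicSimpleGroups G := by
  have hcomm : (∀ a b : G, a * b = b * a) → IsProductOfIsomorphicSimpleGroups G := fun hc =>
    let _ : CommGroup G := { mul_comm := hc }
    h.isProduct_of_commGroup
  rcases h.lift_eq_one_or (FreeGroup.of 0 * FreeGroup.of 1 * (FreeGroup.of 0)⁻¹ * (FreeGroup.of 1)⁻¹) with hc | hc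
  · refine hcomm fun a b => ?_
    have := hc fun n => if n = 0 then a else b
    simpa [mul_inv_eq_iff_eq_mul] using this
  · rcases subsingleton_or_nontrivial G with hs | hn
    · exact hcomm fun a b => Subsingleton.elim _ _
    · refine h.isProduct_of_perfect (top_le_iff.1 (hc ▸ ?_))
      rw [verbalSubgroup, Subgroup.closure_le]
      rintro _ ⟨_, rfl, v, rfl⟩
      simp only [map_mul, map_inv, FreeGroup.lift_apply_of]
      exact Subgroup.commutator_mem_commutator (Subgroup.mem_top _) (Subgroup.mem_top _)

theorem mainTheorem10 (G : Type u) [Group G] [Finite G] :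
    List.TFAE [IsCharacteristicallySimple G, IsInvariantlySimple G, IsVerballySimple G,
      IsProductOfIsomorphicSimpleGroups G] := by
  tfae_have 1 → 2 := fun h H hH => h H hH.characteristic
  tfae_have 2 → 3 := fun h H hH => h H hH.isFullyInvariant
  tfae_have 3 → 4 := fun h => h.isProductOfIsomorphicSimpleGroups
  tfae_have 4 → 1 := fun h => h.isCharacteristicallySimple
  tfae_finish
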